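/- Let $\Bbbk$ be a field of characteristic zero and let $W_+$ be the positive Witt algebra, that is, the Lie algebra over $\Bbbk$ with basis $\{e_n : n \in \mathbb{Z}_{\ge 1}\}$ and Lie bracket $[e_i, e_j] = (j-i)e_{i+j}$. Let $\mathrm{U}(W_+)$ be its universal enveloping algebra with the order filtration, where $U_n$ is the span of all products of at most $n$ elements of $W_+$ and $U_{-1} = 0$, and identify the associated graded ring of this filtration with the symmetric algebra $\mathrm{S}(W_+)$ in the canonical way. For a two-sided ideal $J$ of $\mathrm{U}(W_+)$ let $$\operatorname{gr} J = \bigoplus_{n \ge 0} \bigl((J \cap U_n) + U_{n-1}\bigr)/U_{n-1} \subseteq \mathrm{S}(W_+)$$ be its associated graded ideal. Then $\mathrm{U}(W_+)$ satisfies the ascending chain condition on two-sided ideals whose associated graded ideals are radical: if $J_0 \subseteq J_1 \subseteq J_2 \subseteq \cdots$ are two-sided ideals of $\mathrm{U}(W_+)$ such that $\operatorname{gr} J_n$ is a radical ideal of $\mathrm{S}(W_+)$ for every $n \ge 0$, then there is an $N$ with $J_n = J_N$ for all $n \ge N$. -/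

import Mathlib

/-- The underlying vector space of the positive Witt algebra `W₊` over `k`:
it has the basis `e n`, `n ∈ ℤ_{≥ 1}`. -/
def PositiveWitt (k : Type*) [Field k] : Type _ := ℕ+ →₀ k

namespace PositiveWitt

noncomputable section

variable {k : Type*} [Field k]

instance : AddCommGroup (PositiveWitt k) := inferInstanceAs (AddCommGroup (ℕ+ →₀ k))

instance : Module k (PositiveWitt k) := inferInstanceAs (Module k (ℕ+ →₀ k))

variable (k) in
/-- The standard basis of `W₊`. -/
def basis : Module.Basis ℕ+ k (PositiveWitt k) := Module.Basis.ofRepr (LinearEquiv.refl k (ℕ+ →₀ k))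

variable (k) in
/-- The basis vector `e n`. -/
def e (n : ℕ+) : PositiveWitt k := basis k n

variable (k) in
/-- The bilinear extension of `[e i, e j] = (j - i) e (i + j)`. -/
def bracketBilin : PositiveWitt k →ₗ[k] PositiveWitt k →ₗ[k] PositiveWitt k :=
  (basis k).constr k fun i => (basis k).constr k fun j =>
    (((j : ℕ) : k) - ((i : ℕ) : k)) • e k (i + j)

instance : Bracket (PositiveWitt k) (PositiveWitt k) := ⟨fun x y => bracketBilin k x y⟩

theorem bracket_def (x y : PositiveWitt k) : ⁅x, y⁆ = bracketBilin k x y := rfl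

theorem bracketBilin_e_e (i j : ℕ+) :
    bracketBilin k (e k i) (e k j) = (((j : ℕ) : k) - ((i : ℕ) : k)) • e k (i + j) := by
  simp [bracketBilin, e]

theorem lie_e_e (i j : ℕ+) :
    ⁅e k i, e k j⁆ = (((j : ℕ) : k) - ((i : ℕ) : k)) • e k (i + j) :=
  bracketBilin_e_e i j

theorem bracketBilin_swap (x y : PositiveWitt k) :
    bracketBilin k x y = - bracketBilin k y x := by
  have h : bracketBilin k = - (bracketBilin k).flip := by
    refine (basis k).ext fun i => (basis k).ext fun j => ?_
    change bracketBilin k (e k i) (e k j) = - bracketBilin k (e k j) (e k i)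
    rw [bracketBilin_e_e, bracketBilin_e_e, add_comm j i, ← neg_smul, neg_sub]
  exact congrArg (fun B => B x y) h

theorem bracketBilin_leibniz (x y z : PositiveWitt k) :
    bracketBilin k x (bracketBilin k y z) =
      bracketBilin k (bracketBilin k x y) z + bracketBilin k y (bracketBilin k x z) := by
  let B := bracketBilin k
  have key : ∀ i j l : ℕ+, B (e k i) (B (e k j) (e k l)) =
      B (B (e k i) (e k j)) (e k l) + B (e k j) (B (e k i) (e k l)) := by
    intro i j l
    simp only [B, bracketBilin_e_e, map_smul, LinearMap.smul_apply, smul_smul]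
    rw [← add_assoc i j l, show j + (i + l) = i + j + l by rw [← add_assoc, add_comm j i],
      ← add_smul]
    congr 1
    push_cast
    ring
  have h1 : ∀ (i j : ℕ+) (z : PositiveWitt k), B (e k i) (B (e k j) z) =
      B (B (e k i) (e k j)) z + B (e k j) (B (e k i) z) := by
    intro i j z
    have h : (B (e k i)) ∘ₗ (B (e k j)) =
        B (B (e k i) (e k j)) + (B (e k j)) ∘ₗ (B (e k i)) :=
      (basis k).ext fun l => key i j l
    exact LinearMap.congr_fun h z
  have h2 : ∀ (i : ℕ+) (y z : PositiveWitt k), B (e k i) (B y z) =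
      B (B (e k i) y) z + B y (B (e k i) z) := by
    intro i y z
    have h : (B (e k i)) ∘ₗ (B.flip z) =
        (B.flip z) ∘ₗ (B (e k i)) + B.flip (B (e k i) z) :=
      (basis k).ext fun j => h1 i j z
    exact LinearMap.congr_fun h y
  have h : B.flip (B y z) = (B.flip z) ∘ₗ (B.flip y) + (B y) ∘ₗ (B.flip z) :=
    (basis k).ext fun i => h2 i y z
  exact LinearMap.congr_fun h x

variable [CharZero k]

instance : LieRing (PositiveWitt k) where
  add_lie x y z := by simp [bracket_def]
  lie_add x y z := by simp [bracket_def]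
  lie_self x := by
    have h : bracketBilin k x x = - bracketBilin k x x := bracketBilin_swap x x
    have h2 : (2 : k) • bracketBilin k x x = 0 := by
      rw [two_smul]; nth_rewrite 1 [h]; simp
    exact (smul_eq_zero.mp h2).resolve_left two_ne_zero
  leibniz_lie x y z := bracketBilin_leibniz x y z

instance : LieAlgebra k (PositiveWitt k) where
  lie_smul t x y := by simp [bracket_def]

end

end PositiveWitt

namespace UniversalEnvelopingAlgebra

noncomputable section

variable (R : Type*) (L : Type*) [CommRing R] [LieRing L] [LieAlgebra R L]

/-- The step `U_{< n}` of the order filtration of `U(L)`: the span of all products of fewer than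
`n` elements of `L`. For `n ≥ 1` it is `U_{n - 1}`, and `U_{< 0} = 0`. -/
def orderLT (n : ℕ) : Submodule R (UniversalEnvelopingAlgebra R L) :=
  ⨆ i : Fin n, LinearMap.range ((mkAlgHom R L).toLinearMap ∘ₗ TensorAlgebra.ι R) ^ (i : ℕ)

/-- `f ∈ S(L)` is the `n`-th symbol of `u ∈ U_n`, that is, `f` is homogeneous of degree `n` and
corresponds to the class of `u` in `U_n / U_{n - 1}` under the canonical map
`Sⁿ(L) → U_n / U_{n - 1}`, `x₁ ⋯ xₙ ↦ [x₁ ⋯ xₙ]`. The map is described through the homogeneous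
part `Tⁿ(L)` of the tensor algebra, which surjects onto `Sⁿ(L)` and onto `U_n / U_{n - 1}`. -/
def IsSymbol (n : ℕ) (u : UniversalEnvelopingAlgebra R L) (f : SymmetricAlgebra R L) : Prop :=
  ∃ t ∈ LinearMap.range (TensorAlgebra.ι R : L →ₗ[R] TensorAlgebra R L) ^ n,
    u - mkAlgHom R L t ∈ orderLT R L n ∧ SymmetricAlgebra.algHom R L t = f

variable {R L}

/-- The associated graded ideal `gr J = ⨁ₙ (J ∩ U_n + U_{n - 1}) / U_{n - 1}` of a two-sided ideal
`J` of `U(L)` for the order filtration, as an ideal of `S(L) = gr U(L)`: it is spanned by the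
symbols of the elements of `J`. -/
def grIdeal (J : TwoSidedIdeal (UniversalEnvelopingAlgebra R L)) :
    Ideal (SymmetricAlgebra R L) :=
  Ideal.span {f | ∃ n : ℕ, ∃ u ∈ J, IsSymbol R L n u f}

end

end UniversalEnvelopingAlgebra

/-! Write `D` for the Poisson bracket with `e 1` on `S(W₊)`. Commutators with `e 1` preserve each
two-sided ideal `J`, so `gr J` is stable under `D`; being radical, it is a radical differential
ideal. Moreover `D e_n = (n - 1) e_{n+1}`. Hence `D` vanishes on `A = k[e_1]`, which is Noetherian,
and in characteristic zero the iterated derivatives of `e_2` generate `S(W₊)` over `A`. The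
Ritt–Raudenbush theorem then gives the ascending chain condition for radical differential ideals, so
the chain `gr J_n` stops. Since `I ⊆ J` and `gr J ⊆ gr I` force `I = J` (`eq_of_le_of_grIdeal_le`),
the chain `J_n` stops too. The Poincaré–Birkhoff–Witt theorem is not needed: it suffices that `Sⁿ(L)
→ U_n / U_{n-1}` is well defined and onto.

For Ritt–Raudenbush (`IsRadicalDifferential.isRadicalFG`), a counterexample yields by Zorn a maximal
one `P`, which is prime. Let `Q` be the ideal generated by `P ∩ A`, and take `f ∈ P` outside `Q` of
least order in the `y n`, then of least degree in its top variable. By minimality the initial `c`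
and the separant `s` of `f` lie outside `P`. Let `B` be the radical differential ideal generated by
`f` and finitely many generators of `P ∩ A`. Modulo `B`, multiplying `x ∈ P` by powers of `s` and
`c` leaves a remainder smaller than `f`; it is in `P`, hence in `Q ⊆ B`. So `c s P ⊆ B` with `c s ∉
P`, which makes `P` of finite type. The `y n` need not be algebraically independent: order and
degree refer to some polynomial expression. -/

/-! ### Radical differential ideals and maximal ones not of finite type -/

namespace Derivation

variable {k R : Type*} [CommRing k] [CommRing R] [Algebra k R] (D : Derivation k R R)

/-- A radical differential ideal: a radical ideal which is stable under the derivation `D`. -/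
structure IsRadicalDifferential (I : Ideal R) : Prop where
  isRadical : I.IsRadical
  map_mem : ∀ f ∈ I, D f ∈ I

/-- Membership in the radical differential ideal generated by `s`. -/
inductive MemRadicalClosure (s : Set R) : R → Prop
  | of {f : R} (hf : f ∈ s) : MemRadicalClosure s f
  | zero : MemRadicalClosure s 0
  | add {f g : R} (hf : MemRadicalClosure s f) (hg : MemRadicalClosure s g) :
      MemRadicalClosure s (f + g)
  | mul (a : R) {f : R} (hf : MemRadicalClosure s f) : MemRadicalClosure s (a * f)
  | map {f : R} (hf : MemRadicalClosure s f) : MemRadicalClosure s (D f)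
  | root {f : R} (n : ℕ) (hf : MemRadicalClosure s (f ^ n)) : MemRadicalClosure s f

/-- The radical differential ideal generated by `s`. -/
def radicalClosure (s : Set R) : Ideal R where
  carrier := {f | D.MemRadicalClosure s f}
  add_mem' := .add
  zero_mem' := .zero
  smul_mem' a _ h := .mul a h

variable {D}

theorem subset_radicalClosure (s : Set R) : s ⊆ D.radicalClosure s := fun _ h => .of h

theorem isRadicalDifferential_radicalClosure (s : Set R) :
    D.IsRadicalDifferential (D.radicalClosure s) :=
  ⟨fun _ ⟨n, h⟩ => .root n h, fun _ h => .map h⟩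

theorem radicalClosure_le {s : Set R} {I : Ideal R} (hI : D.IsRadicalDifferential I)
    (hs : s ⊆ I) : D.radicalClosure s ≤ I := by
  intro f hf
  change D.MemRadicalClosure s f at hf
  induction hf with
  | of h => exact hs h
  | zero => exact I.zero_mem
  | add hf hg h₁ h₂ => exact I.add_mem h₁ h₂
  | mul a hf h => exact I.mul_mem_left a h
  | map hf h => exact hI.map_mem _ h
  | root n hf h => exact hI.isRadical ⟨n, h⟩

theorem radicalClosure_mono {s t : Set R} (h : s ⊆ t) :
    D.radicalClosure s ≤ D.radicalClosure t :=
  radicalClosure_le (isRadicalDifferential_radicalClosure t) (h.trans (subset_radicalClosure t))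

/-- Membership is witnessed by a finite derivation tree, which uses only finitely many generators.
-/
theorem exists_finset_mem_radicalClosure {s : Set R} {f : R} (hf : f ∈ D.radicalClosure s) :
    ∃ F : Finset R, (F : Set R) ⊆ s ∧ f ∈ D.radicalClosure (F : Set R) := by
  classical
  change D.MemRadicalClosure s f at hf
  induction hf with
  | @of f h => exact ⟨{f}, by simpa using h, .of (by simp)⟩
  | zero => exact ⟨∅, by simp, Ideal.zero_mem _⟩
  | add hf hg h₁ h₂ =>
    obtain ⟨F, hF, hF'⟩ := h₁
    obtain ⟨G, hG, hG'⟩ := h₂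
    refine ⟨F ∪ G, by simp [hF, hG], Ideal.add_mem _ ?_ ?_⟩
    · exact radicalClosure_mono (by simp) hF'
    · exact radicalClosure_mono (by simp) hG'
  | mul a hf h =>
    obtain ⟨F, hF, hF'⟩ := h
    exact ⟨F, hF, Ideal.mul_mem_left _ a hF'⟩
  | map hf h =>
    obtain ⟨F, hF, hF'⟩ := h
    exact ⟨F, hF, .map hF'⟩
  | root n hf h =>
    obtain ⟨F, hF, hF'⟩ := h
    exact ⟨F, hF, .root n hF'⟩

theorem exists_finset_subset_radicalClosure {s : Set R} (G : Finset R)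
    (hG : (G : Set R) ⊆ D.radicalClosure s) :
    ∃ F : Finset R, (F : Set R) ⊆ s ∧ (G : Set R) ⊆ D.radicalClosure (F : Set R) := by
  classical
  induction G using Finset.induction_on with
  | empty => exact ⟨∅, by simp, by simp⟩
  | insert a G _ ih =>
    rw [Finset.coe_insert, Set.insert_subset_iff] at hG
    obtain ⟨F, hF, hF'⟩ := ih hG.2
    obtain ⟨E, hE, hE'⟩ := exists_finset_mem_radicalClosure hG.1
    refine ⟨E ∪ F, by simp [hE, hF], ?_⟩
    rw [Finset.coe_insert, Set.insert_subset_iff]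
    exact ⟨radicalClosure_mono (by simp) hE', hF'.trans (radicalClosure_mono (by simp))⟩

/-- If `I` is a radical differential ideal then so is `(I : a)`; stated for generated ideals. -/
theorem IsRadicalDifferential.mul_mem_of_mem_radicalClosure {I : Ideal R}
    (hI : D.IsRadicalDifferential I) {s : Set R} {a f : R} (hs : ∀ b ∈ s, a * b ∈ I)
    (hf : f ∈ D.radicalClosure s) : a * f ∈ I := by
  change D.MemRadicalClosure s f at hf
  induction hf with
  | of h => exact hs _ h
  | zero => simp
  | add hf hg h₁ h₂ => rw [mul_add]; exact I.add_mem h₁ h₂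
  | mul b hf h => rw [mul_left_comm]; exact I.mul_mem_left b h
  | @map f hf h =>
    -- `(a * D f) ^ 2 = a * D f * D (a * f) - D a * D f * (a * f)`, and `a * f ∈ I`.
    refine hI.isRadical ⟨2, ?_⟩
    have h₁ : D (a * f) ∈ I := hI.map_mem _ h
    have h₂ := I.sub_mem (I.mul_mem_left (a * D f) h₁) (I.mul_mem_left (D a * D f) h)
    rw [D.leibniz, smul_eq_mul, smul_eq_mul] at h₂
    convert h₂ using 1
    ring
  | @root f n hf h =>
    refine hI.isRadical ⟨n + 1, ?_⟩
    have h₁ := I.mul_mem_left (a ^ n * f) h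
    convert h₁ using 1
    ring

variable (D) in
/-- A radical differential ideal is of finite type if it is generated, as a radical differential
ideal, by a finite set. -/
def IsRadicalFG (I : Ideal R) : Prop := ∃ F : Finset R, I = D.radicalClosure (F : Set R)

/-- Zorn's lemma applies because a finite generating set of the union of a chain already lies in one
member, which would then equal the union. -/
theorem exists_maximal_not_isRadicalFG {I : Ideal R} (hI : D.IsRadicalDifferential I)
    (hfg : ¬ D.IsRadicalFG I) :
    ∃ P, Maximal (fun P => D.IsRadicalDifferential P ∧ ¬ D.IsRadicalFG P) P := by
  suffices h : ∃ P, I ≤ P ∧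
      Maximal (· ∈ {P : Ideal R | D.IsRadicalDifferential P ∧ ¬ D.IsRadicalFG P}) P from
    h.imp fun _ => And.right
  refine zorn_le_nonempty₀ _ ?_ I ⟨hI, hfg⟩
  intro c hc hchain y hy
  have hdir : DirectedOn (· ≤ ·) c := hchain.directedOn
  have hmem {x : R} : x ∈ sSup c ↔ ∃ Q ∈ c, x ∈ Q := Submodule.mem_sSup_of_directed ⟨y, hy⟩ hdir
  refine ⟨sSup c, ⟨⟨?_, ?_⟩, ?_⟩, fun z hz => le_sSup hz⟩
  · rintro f ⟨n, hf⟩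
    obtain ⟨Q, hQ, hfQ⟩ := hmem.1 hf
    exact hmem.2 ⟨Q, hQ, (hc hQ).1.isRadical ⟨n, hfQ⟩⟩
  · intro f hf
    obtain ⟨Q, hQ, hfQ⟩ := hmem.1 hf
    exact hmem.2 ⟨Q, hQ, (hc hQ).1.map_mem f hfQ⟩
  · rintro ⟨F, hF⟩
    have hsub : (F : Set R) ⊆ (sSup c : Ideal R) := hF ▸ subset_radicalClosure _
    have : ∃ Q ∈ c, (F : Set R) ⊆ Q := by
      classical
      clear hF
      induction F using Finset.induction_on with
      | empty => exact ⟨y, hy, by simp⟩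
      | insert a F _ ih =>
        rw [Finset.coe_insert, Set.insert_subset_iff] at hsub
        obtain ⟨Q, hQ, hFQ⟩ := ih hsub.2
        obtain ⟨Q', hQ', haQ'⟩ := hmem.1 hsub.1
        obtain ⟨Q'', hQ'', h₁, h₂⟩ := hdir Q hQ Q' hQ'
        refine ⟨Q'', hQ'', ?_⟩
        rw [Finset.coe_insert, Set.insert_subset_iff]
        exact ⟨h₂ haQ', hFQ.trans h₁⟩
    obtain ⟨Q, hQ, hFQ⟩ := this
    refine (hc hQ).2 ⟨F, le_antisymm ?_ (radicalClosure_le (hc hQ).1 hFQ)⟩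
    exact hF ▸ le_sSup hQ

section Maximal

variable {P : Ideal R} (hP : Maximal (fun P => D.IsRadicalDifferential P ∧ ¬ D.IsRadicalFG P) P)

include hP

/-- By maximality the radical differential ideal generated by `P` and `a` is of finite type, and by
finiteness of derivations its generators can be taken from `P ∪ {a}`. -/
theorem exists_finset_of_maximal {a : R} (ha : a ∉ P) :
    ∃ F : Finset R, (F : Set R) ⊆ P ∧ ∀ x ∈ P, x ∈ D.radicalClosure (insert a (F : Set R)) := by
  classical
  have hle : P ≤ D.radicalClosure (insert a (P : Set R)) :=
    fun x hx => subset_radicalClosure _ (Set.mem_insert_of_mem a hx)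
  have hfg : D.IsRadicalFG (D.radicalClosure (insert a (P : Set R))) := by
    by_contra h
    exact ha (hP.2 ⟨isRadicalDifferential_radicalClosure _, h⟩ hle
      (subset_radicalClosure _ (Set.mem_insert a _)))
  obtain ⟨G, hG⟩ := hfg
  obtain ⟨F, hF, hGF⟩ := exists_finset_subset_radicalClosure (D := D) (s := insert a (P : Set R)) G
    (by rw [hG]; exact subset_radicalClosure _)
  refine ⟨F.filter (· ∈ P), by simp +contextual [Set.subset_def], fun x hx => ?_⟩
  have hxG : x ∈ D.radicalClosure (G : Set R) := hG ▸ hle hx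
  have hxF := radicalClosure_le (isRadicalDifferential_radicalClosure _) hGF hxG
  refine radicalClosure_mono (fun y hy => ?_) hxF
  rcases hF hy with rfl | hyP
  · exact Set.mem_insert _ _
  · exact Set.mem_insert_of_mem _ (by simpa using ⟨hy, hyP⟩)

/-- If neither factor is in `P`, let finite `F, G ⊆ P` be such that `{a} ∪ F` and `{b} ∪ G` each
generate an ideal containing `P`. For `x ∈ P`, multiplying by `b` and then by `x` puts `x * x` into
the ideal generated by `a * b`, `F` and `G`, so `P` would be of finite type. -/
theorem mem_or_mem_of_maximal {a b : R} (hab : a * b ∈ P) : a ∈ P ∨ b ∈ P := by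
  classical
  by_contra! h
  obtain ⟨F, hF, hF'⟩ := exists_finset_of_maximal hP h.1
  obtain ⟨G, hG, hG'⟩ := exists_finset_of_maximal hP h.2
  let T : Finset R := insert (a * b) (F ∪ G)
  have hT : (T : Set R) ⊆ P := by
    simp [T, Set.insert_subset_iff, hF, hG, hab]
  have hTI := isRadicalDifferential_radicalClosure (D := D) (T : Set R)
  have hsub {y : R} (hy : y ∈ T) : y ∈ D.radicalClosure (T : Set R) :=
    subset_radicalClosure (D := D) (T : Set R) hy
  refine hP.1.2 ⟨T, le_antisymm (fun x hx => ?_) (radicalClosure_le hP.1.1 hT)⟩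
  have h₁ : b * x ∈ D.radicalClosure (T : Set R) := by
    refine hTI.mul_mem_of_mem_radicalClosure ?_ (hF' x hx)
    rintro y (rfl | hy)
    · rw [mul_comm]; exact hsub (by simp [T])
    · exact Ideal.mul_mem_left _ _ (hsub (by simp [T, Finset.mem_coe.1 hy]))
  have h₂ : x * x ∈ D.radicalClosure (T : Set R) := by
    refine hTI.mul_mem_of_mem_radicalClosure ?_ (hG' x hx)
    rintro y (rfl | hy)
    · rwa [mul_comm]
    · exact Ideal.mul_mem_left _ _ (hsub (by simp [T, Finset.mem_coe.1 hy]))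
  exact hTI.isRadical ⟨2, by rwa [pow_two]⟩

/-- No finite subset `F` of `P` and `a ∉ P` satisfy `a P ⊆ {F}`. -/
theorem exists_mul_notMem_of_maximal {a : R} (ha : a ∉ P) (F : Finset R) (hF : (F : Set R) ⊆ P) :
    ∃ x ∈ P, a * x ∉ D.radicalClosure (F : Set R) := by
  classical
  by_contra! h
  obtain ⟨G, hG, hG'⟩ := exists_finset_of_maximal hP ha
  have hTI := isRadicalDifferential_radicalClosure (D := D) ((F ∪ G : Finset R) : Set R)
  refine hP.1.2 ⟨F ∪ G, le_antisymm (fun x hx => ?_) (radicalClosure_le hP.1.1 (by simp [hF, hG]))⟩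
  -- `x` lies in the closure of `a` and `G`, and `x * a` and `x * G` lie in the closure of `F ∪ G`;
  -- hence so does `x * x`.
  refine hTI.isRadical ⟨2, ?_⟩
  rw [pow_two]
  refine hTI.mul_mem_of_mem_radicalClosure ?_ (hG' x hx)
  rintro y (rfl | hy)
  · rw [mul_comm]
    exact radicalClosure_mono (by simp) (h x hx)
  · refine Ideal.mul_mem_left _ _ (subset_radicalClosure _ ?_)
    simp [Finset.mem_coe.1 hy]

end Maximal

end Derivation

/-! ### Order, degree and reduction by the initial and the separant -/

namespace Derivation

open Algebra

variable {k R : Type*} [CommRing k] [CommRing R] [Algebra k R] (A : Subalgebra k R) (y : ℕ → R)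

/-- The subalgebra generated by `A` and `y 0, …, y (n - 1)`. -/
def level (n : ℕ) : Subalgebra k R := adjoin k ((A : Set R) ∪ y '' Set.Iio n)

/-- The polynomials in `y n` of degree less than `d` with coefficients in `level A y n`. -/
def degreeBelow (n d : ℕ) : Submodule (level A y n) R :=
  Submodule.span (level A y n) ((fun j => y n ^ j) '' Set.Iio d)

variable {A y}

theorem level_mono {m n : ℕ} (h : m ≤ n) : level A y m ≤ level A y n :=
  adjoin_mono (Set.union_subset_union_right _ (Set.image_mono (Set.Iio_subset_Iio h)))

theorem level_zero : level A y 0 = A := by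
  simpa [level] using adjoin_eq A

theorem gen_mem_level {i n : ℕ} (h : i < n) : y i ∈ level A y n :=
  subset_adjoin (Or.inr ⟨i, h, rfl⟩)

theorem exists_mem_level (hgen : adjoin k ((A : Set R) ∪ Set.range y) = ⊤) (x : R) :
    ∃ n, x ∈ level A y n := by
  have hx : x ∈ adjoin k ((A : Set R) ∪ Set.range y) := hgen ▸ mem_top
  induction hx using adjoin_induction with
  | mem x hx =>
    rcases hx with hx | ⟨i, rfl⟩
    · exact ⟨0, subset_adjoin (Or.inl hx)⟩
    · exact ⟨i + 1, gen_mem_level i.lt_succ_self⟩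
  | algebraMap r => exact ⟨0, Subalgebra.algebraMap_mem _ r⟩
  | add x z _ _ hx hz =>
    obtain ⟨m, hm⟩ := hx
    obtain ⟨n, hn⟩ := hz
    exact ⟨max m n, add_mem (level_mono (le_max_left m n) hm) (level_mono (le_max_right m n) hn)⟩
  | mul x z _ _ hx hz =>
    obtain ⟨m, hm⟩ := hx
    obtain ⟨n, hn⟩ := hz
    exact ⟨max m n, mul_mem (level_mono (le_max_left m n) hm) (level_mono (le_max_right m n) hn)⟩

theorem degreeBelow_mono {n d e : ℕ} (h : d ≤ e) : degreeBelow A y n d ≤ degreeBelow A y n e :=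
  Submodule.span_mono (Set.image_mono (Set.Iio_subset_Iio h))

theorem mul_mem_degreeBelow {n d : ℕ} {c x : R} (hc : c ∈ level A y n)
    (hx : x ∈ degreeBelow A y n d) : c * x ∈ degreeBelow A y n d :=
  (degreeBelow A y n d).smul_mem ⟨c, hc⟩ hx

theorem pow_mem_degreeBelow {n d j : ℕ} (h : j < d) : y n ^ j ∈ degreeBelow A y n d :=
  Submodule.subset_span ⟨j, h, rfl⟩

theorem degreeBelow_zero (n : ℕ) : degreeBelow A y n 0 = ⊥ := by
  simp [degreeBelow]

theorem mem_degreeBelow_of_mem_level {n d : ℕ} (hd : 0 < d) {x : R} (hx : x ∈ level A y n) :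
    x ∈ degreeBelow A y n d := by
  simpa using mul_mem_degreeBelow hx (pow_mem_degreeBelow (A := A) (y := y) (n := n) hd)

theorem mem_degreeBelow_succ {n d : ℕ} {x : R} (hx : x ∈ degreeBelow A y n (d + 1)) :
    ∃ g ∈ degreeBelow A y n d, ∃ c ∈ level A y n, x = g + c * y n ^ d := by
  have h : (fun j => y n ^ j) '' Set.Iio (d + 1) =
      insert (y n ^ d) ((fun j => y n ^ j) '' Set.Iio d) := by
    rw [← Set.image_insert_eq]
    congr 1
    ext j
    simp [le_iff_eq_or_lt]
  rw [degreeBelow, h, Submodule.mem_span_insert] at hx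
  obtain ⟨c, g, hg, rfl⟩ := hx
  exact ⟨g, hg, c, c.2, add_comm _ _⟩

theorem mem_level_of_mem_degreeBelow_one {n : ℕ} {x : R} (hx : x ∈ degreeBelow A y n 1) :
    x ∈ level A y n := by
  obtain ⟨g, hg, c, hc, rfl⟩ := mem_degreeBelow_succ hx
  rw [degreeBelow_zero, Submodule.mem_bot] at hg
  simpa [hg] using hc

theorem mem_level_succ_of_mem_degreeBelow {n d : ℕ} {x : R} (hx : x ∈ degreeBelow A y n d) :
    x ∈ level A y (n + 1) := by
  induction hx using Submodule.span_induction with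
  | mem x hx =>
    obtain ⟨j, -, rfl⟩ := hx
    exact pow_mem (gen_mem_level n.lt_succ_self) j
  | zero => exact zero_mem _
  | add x z _ _ hx hz => exact add_mem hx hz
  | smul c x _ hx => exact mul_mem (level_mono n.le_succ c.2) hx

theorem gen_mul_mem_degreeBelow {n d : ℕ} {x : R} (hx : x ∈ degreeBelow A y n d) :
    y n * x ∈ degreeBelow A y n (d + 1) := by
  induction hx using Submodule.span_induction with
  | mem x hx =>
    obtain ⟨j, hj, rfl⟩ := hx
    simpa [pow_succ'] using
      pow_mem_degreeBelow (A := A) (y := y) (n := n) (Nat.succ_lt_succ (Set.mem_Iio.1 hj))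
  | zero => simp
  | add x z _ _ hx hz => rw [mul_add]; exact add_mem hx hz
  | smul c x _ hx =>
    rw [mul_smul_comm]
    exact Submodule.smul_mem _ c hx

/-- A `level A y n`-submodule stable under multiplication by `y n` is stable under
multiplication by `level A y (n + 1)`. -/
theorem mul_mem_of_mem_level_succ {n : ℕ} (M : Submodule (level A y n) R)
    (hM : ∀ x ∈ M, y n * x ∈ M) {a x : R} (ha : a ∈ level A y (n + 1)) (hx : x ∈ M) :
    a * x ∈ M := by
  have hlevel {c z : R} (hc : c ∈ level A y n) (hz : z ∈ M) : c * z ∈ M := M.smul_mem ⟨c, hc⟩ hz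
  induction ha using adjoin_induction generalizing x with
  | mem a ha =>
    rcases ha with ha | ⟨i, hi, rfl⟩
    · exact hlevel (subset_adjoin (Or.inl ha)) hx
    · rcases (Nat.lt_succ_iff.1 hi).lt_or_eq with hi | rfl
      · exact hlevel (gen_mem_level hi) hx
      · exact hM x hx
  | algebraMap r => exact hlevel (Subalgebra.algebraMap_mem _ r) hx
  | add a b _ _ ha hb => rw [add_mul]; exact M.add_mem (ha hx) (hb hx)
  | mul a b _ _ ha hb => rw [mul_assoc]; exact ha (hb hx)

theorem exists_mem_degreeBelow {n : ℕ} {x : R} (hx : x ∈ level A y (n + 1)) :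
    ∃ d, x ∈ degreeBelow A y n d := by
  have hmem {z : R} : z ∈ ⨆ d, degreeBelow A y n d ↔ ∃ d, z ∈ degreeBelow A y n d :=
    Submodule.mem_iSup_of_directed _ (Monotone.directed_le fun _ _ => degreeBelow_mono)
  rw [← hmem, ← mul_one x]
  refine mul_mem_of_mem_level_succ _ (fun z hz => ?_) hx
    (hmem.2 ⟨1, mem_degreeBelow_of_mem_level one_pos (one_mem _)⟩)
  obtain ⟨d, hd⟩ := hmem.1 hz
  exact hmem.2 ⟨d + 1, gen_mul_mem_degreeBelow hd⟩

/-- Modulo an ideal containing `g + c * y n ^ (d + 1)`, with `g` of smaller degree in `y n`, a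
power of `c` multiplies `level A y (n + 1)` into the polynomials of degree at most `d`
in `y n`. -/
theorem exists_initial_pow_mul_sub_mem {B : Ideal R} {n d : ℕ} {g c : R}
    (hg : g ∈ degreeBelow A y n (d + 1)) (hc : c ∈ level A y n)
    (hf : g + c * y n ^ (d + 1) ∈ B) {x : R} (hx : x ∈ level A y (n + 1)) :
    ∃ N, ∃ r ∈ degreeBelow A y n (d + 1), c ^ N * x - r ∈ B := by
  -- The reducible elements contain `1`; it remains to see that they are stable under multiplication
  -- by `y n`.
  let M : Submodule (level A y n) R :=
    { carrier := {x | ∃ N, ∃ r ∈ degreeBelow A y n (d + 1), c ^ N * x - r ∈ B}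
      add_mem' := by
        rintro a b ⟨M, r, hr, hra⟩ ⟨N, t, ht, htb⟩
        refine ⟨M + N, c ^ N * r + c ^ M * t, add_mem (mul_mem_degreeBelow (pow_mem hc _) hr)
          (mul_mem_degreeBelow (pow_mem hc _) ht), ?_⟩
        convert B.add_mem (B.mul_mem_left (c ^ N) hra) (B.mul_mem_left (c ^ M) htb) using 1
        ring
      zero_mem' := ⟨0, 0, zero_mem _, by simp⟩
      smul_mem' := by
        rintro a b ⟨N, r, hr, hrb⟩
        refine ⟨N, a * r, mul_mem_degreeBelow a.2 hr, ?_⟩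
        convert B.mul_mem_left a hrb using 1
        rw [Subalgebra.smul_def, smul_eq_mul]
        ring }
  have h1 : (1 : R) ∈ M :=
    ⟨0, 1, mem_degreeBelow_of_mem_level d.succ_pos (one_mem _), by simp⟩
  rw [← mul_one x]
  refine mul_mem_of_mem_level_succ M ?_ hx h1
  rintro z ⟨N, r, hr, hrz⟩
  obtain ⟨g', hg', c', hc', rfl⟩ := mem_degreeBelow_succ hr
  -- One step of pseudo-division: `c * y n * (g' + c' * y n ^ d) - c' * (g + c * y n ^ (d + 1))` has
  -- no term of degree `d + 1`.
  refine ⟨N + 1, c * (y n * g') - c' * g, sub_mem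
    (mul_mem_degreeBelow hc (gen_mul_mem_degreeBelow hg')) (mul_mem_degreeBelow hc' hg), ?_⟩
  convert B.add_mem (B.mul_mem_left (c * y n) hrz) (B.mul_mem_left c' hf) using 1
  ring

variable {D : Derivation k R R} (hA : ∀ a ∈ A, D a = 0) (hy : ∀ n, D (y n) = y (n + 1))

include hA hy

theorem map_mem_level_succ {n : ℕ} {x : R} (hx : x ∈ level A y n) : D x ∈ level A y (n + 1) := by
  induction hx using adjoin_induction with
  | mem x hx =>
    rcases hx with hx | ⟨i, hi, rfl⟩
    · rw [hA x hx]; exact zero_mem _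
    · rw [hy]; exact gen_mem_level (Nat.succ_lt_succ hi)
  | algebraMap r => simp
  | add x z _ _ hx hz => rw [map_add]; exact add_mem hx hz
  | mul x z h₁ h₂ hx hz =>
    rw [D.leibniz]
    exact add_mem (mul_mem (level_mono n.le_succ h₁) hz) (mul_mem (level_mono n.le_succ h₂) hx)

/-- Existence of the separant `s` of `f`. -/
theorem exists_separant {n d : ℕ} {f : R} (hf : f ∈ degreeBelow A y n (d + 1)) :
    ∃ s ∈ degreeBelow A y n d, D f - s * y (n + 1) ∈ level A y (n + 1) ∧
      y n * s - d * f ∈ degreeBelow A y n d := by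
  induction hf using Submodule.span_induction with
  | mem x hx =>
    obtain ⟨j, hj, rfl⟩ := hx
    -- The separant of `y n ^ j` is `j * y n ^ (j - 1)`, with `j = 0` apart. The Euler expression is
    -- then `(j - d) * y n ^ j`, which has degree below `d` or vanishes when `j = d`.
    rcases j with _ | j
    · refine ⟨0, zero_mem _, by simp, ?_⟩
      rcases d.eq_zero_or_pos with rfl | hd
      · simp
      · refine mem_degreeBelow_of_mem_level hd ?_
        simp
    · have hj : j < d := Nat.succ_lt_succ_iff.1 hj
      have hnat (m : ℕ) : (m : R) ∈ level A y n := natCast_mem _ m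
      refine ⟨(j + 1 : ℕ) * y n ^ j, mul_mem_degreeBelow (hnat _) (pow_mem_degreeBelow hj), ?_, ?_⟩
      · have : D (y n ^ (j + 1)) - (j + 1 : ℕ) * y n ^ j * y (n + 1) = 0 := by
          rw [D.leibniz_pow, hy]
          simp [mul_assoc]
        simp only [this]
        exact zero_mem _
      · have heq : y n * ((j + 1 : ℕ) * y n ^ j) - d * y n ^ (j + 1) =
            (((j + 1 : ℕ) : R) - d) * y n ^ (j + 1) := by ring
        simp only [heq]
        rcases (Nat.succ_le_of_lt hj).lt_or_eq with h | h
        · exact mul_mem_degreeBelow (sub_mem (hnat _) (hnat _)) (pow_mem_degreeBelow h)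
        · have : ((j + 1 : ℕ) : R) - d = 0 := by rw [← h]; simp
          rw [this, zero_mul]
          exact zero_mem _
  | zero => exact ⟨0, zero_mem _, by simp, by simp⟩
  | add f g _ _ hf hg =>
    obtain ⟨s, hs, hs₁, hs₂⟩ := hf
    obtain ⟨t, ht, ht₁, ht₂⟩ := hg
    refine ⟨s + t, add_mem hs ht, ?_, ?_⟩
    · convert add_mem hs₁ ht₁ using 1
      rw [map_add]; ring
    · convert add_mem hs₂ ht₂ using 1
      ring
  | smul c f hf' hf =>
    obtain ⟨s, hs, hs₁, hs₂⟩ := hf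
    refine ⟨c * s, mul_mem_degreeBelow c.2 hs, ?_, ?_⟩
    · have h := add_mem (mul_mem (level_mono n.le_succ c.2) hs₁)
        (mul_mem (mem_level_succ_of_mem_degreeBelow hf') (map_mem_level_succ hA hy c.2))
      convert h using 1
      rw [Subalgebra.smul_def, smul_eq_mul, D.leibniz, smul_eq_mul, smul_eq_mul]; ring
    · convert mul_mem_degreeBelow c.2 hs₂ using 1
      rw [Subalgebra.smul_def, smul_eq_mul]; ring

/-- By the Leibniz rule every further derivative of `f` is linear in its top variable with the same
coefficient `s`; differentiating `s` only contributes lower variables. -/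
theorem iterate_sub_mem_level {n : ℕ} {f s : R} (hs : s ∈ level A y (n + 1))
    (hf : D f - s * y (n + 1) ∈ level A y (n + 1)) (m : ℕ) :
    D^[m + 1] f - s * y (n + 1 + m) ∈ level A y (n + 1 + m) := by
  induction m with
  | zero => exact hf
  | succ m ih =>
    have h := add_mem (map_mem_level_succ hA hy ih)
      (mul_mem (level_mono (by omega) (map_mem_level_succ hA hy hs))
        (gen_mem_level (n := n + 1 + m + 1) (Nat.lt_succ_self (n + 1 + m))))
    rw [Function.iterate_succ_apply']
    rw [map_sub, D.leibniz, hy, smul_eq_mul, smul_eq_mul] at h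
    rw [← add_assoc]
    convert h using 1
    ring

/-- Modulo a differential ideal containing `f`, a power of the separant of `f` multiplies
everything into `level A y (n + 1)`. -/
theorem exists_separant_pow_mul_sub_mem (hgen : adjoin k ((A : Set R) ∪ Set.range y) = ⊤)
    {B : Ideal R} (hB : ∀ x ∈ B, D x ∈ B) {n : ℕ} {f s : R} (hfB : f ∈ B)
    (hs : s ∈ level A y (n + 1)) (hf : D f - s * y (n + 1) ∈ level A y (n + 1)) (x : R) :
    ∃ N, ∃ r ∈ level A y (n + 1), s ^ N * x - r ∈ B := by
  let G : Subalgebra k R :=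
    { carrier := {x | ∃ N, ∃ r ∈ level A y (n + 1), s ^ N * x - r ∈ B}
      mul_mem' := by
        rintro a b ⟨M, r, hr, hra⟩ ⟨N, t, ht, htb⟩
        refine ⟨M + N, r * t, mul_mem hr ht, ?_⟩
        convert B.add_mem (B.mul_mem_left (s ^ N * b) hra) (B.mul_mem_left r htb) using 1
        ring
      add_mem' := by
        rintro a b ⟨M, r, hr, hra⟩ ⟨N, t, ht, htb⟩
        refine ⟨M + N, s ^ N * r + s ^ M * t,
          add_mem (mul_mem (pow_mem hs _) hr) (mul_mem (pow_mem hs _) ht), ?_⟩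
        convert B.add_mem (B.mul_mem_left (s ^ N) hra) (B.mul_mem_left (s ^ M) htb) using 1
        ring
      algebraMap_mem' := fun r => ⟨0, algebraMap k R r, Subalgebra.algebraMap_mem _ r, by simp⟩ }
  have hlevel : level A y (n + 1) ≤ G := fun a ha => ⟨0, a, ha, by simp⟩
  have hiter (m : ℕ) : D^[m] f ∈ B := by
    induction m with
    | zero => exact hfB
    | succ m ih => rw [Function.iterate_succ_apply']; exact hB _ ih
  have hG (m : ℕ) : level A y (n + 1 + m) ≤ G := by
    induction m with
    | zero => exact hlevel
    | succ m ih =>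
      refine adjoin_le ?_
      rintro a (ha | ⟨i, hi, rfl⟩)
      · exact hlevel (subset_adjoin (Or.inl ha))
      · rcases (show i < n + 1 + m ∨ i = n + 1 + m by grind) with hi | rfl
        · exact ih (gen_mem_level hi)
        -- As `D^[m + 1] f ∈ B`, the product `s * y (n + 1 + m)` is congruent to minus a lower-order
        -- element, which is reducible by induction.
        · obtain ⟨N, r, hr, h⟩ := ih (iterate_sub_mem_level hA hy hs hf m)
          refine ⟨N + 1, -r, neg_mem hr, ?_⟩
          convert B.sub_mem (B.mul_mem_left (s ^ N) (hiter (m + 1))) h using 1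
          ring
  obtain ⟨m, hm⟩ := exists_mem_level hgen x
  exact hG m (level_mono (by omega) hm)

end Derivation

/-! ### The Ritt–Raudenbush basis theorem -/

namespace Derivation

open Algebra

variable {k R : Type*} [Field k] [CharZero k] [CommRing R] [Algebra k R] {D : Derivation k R R}
  {A : Subalgebra k R} {y : ℕ → R}

/-- The **Ritt–Raudenbush basis theorem** in one differential indeterminate `y 0`, over a
Noetherian ring of constants `A`. -/
theorem IsRadicalDifferential.isRadicalFG [IsNoetherianRing A] (hA : ∀ a ∈ A, D a = 0)
    (hy : ∀ n, D (y n) = y (n + 1)) (hgen : adjoin k ((A : Set R) ∪ Set.range y) = ⊤)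
    {I : Ideal R} (hI : D.IsRadicalDifferential I) : D.IsRadicalFG I := by
  classical
  by_contra hfg
  obtain ⟨P, hP⟩ := exists_maximal_not_isRadicalFG hI hfg
  obtain ⟨E, hE⟩ := (isNoetherianRing_iff_ideal_fg A).1 inferInstance (P.comap A.val)
  let Q : Ideal R := (P.comap A.val).map A.val
  have hQ : Q = Ideal.span ((E.image A.val : Finset R) : Set R) := by
    simp only [Q]
    rw [← hE, Ideal.map_span, Finset.coe_image]
  have hQP : Q ≤ P := Ideal.map_comap_le
  have hEP : ((E.image A.val : Finset R) : Set R) ⊆ P := by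
    intro x hx
    exact hQP (hQ ▸ Ideal.subset_span hx)
  have hQle {F : Finset R} (hF : E.image A.val ⊆ F) : Q ≤ D.radicalClosure (F : Set R) := by
    rw [hQ, Ideal.span_le]
    exact (Finset.coe_subset.2 hF).trans (subset_radicalClosure _)
  have hexists : ∃ n, ∃ x ∈ level A y n, x ∈ P ∧ x ∉ Q := by
    by_contra! h
    refine hP.1.2 ⟨E.image A.val, le_antisymm (fun x hx => ?_) (radicalClosure_le hP.1.1 hEP)⟩
    obtain ⟨n, hn⟩ := exists_mem_level hgen x
    exact hQle subset_rfl (h n x hn hx)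
  obtain ⟨n, hn, hmin⟩ : ∃ n, (∃ x ∈ level A y (n + 1), x ∈ P ∧ x ∉ Q) ∧
      ∀ x ∈ level A y n, x ∈ P → x ∈ Q := by
    have hspec := Nat.find_spec hexists
    have hlt := fun m => Nat.find_min hexists (m := m)
    rcases hN : Nat.find hexists with _ | n
    · rw [hN] at hspec
      obtain ⟨x, hx, hxP, hxQ⟩ := hspec
      rw [level_zero] at hx
      exact absurd (Ideal.mem_map_of_mem A.val (show (⟨x, hx⟩ : A) ∈ P.comap A.val from hxP)) hxQ
    · rw [hN] at hspec hlt
      refine ⟨n, hspec, ?_⟩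
      simpa using hlt n n.lt_succ_self
  -- The least bound is at least `2`: bound `0` leaves only zero, and bound `1` gives elements of
  -- `level A y n`, excluded by minimality of `n`.
  have hexists' : ∃ d, ∃ x ∈ degreeBelow A y n d, x ∈ P ∧ x ∉ Q := by
    obtain ⟨x, hx, hx'⟩ := hn
    obtain ⟨d, hd⟩ := exists_mem_degreeBelow hx
    exact ⟨d, x, hd, hx'⟩
  obtain ⟨d, ⟨f, hf, hfP, hfQ⟩, hmin'⟩ : ∃ d, (∃ x ∈ degreeBelow A y n (d + 2), x ∈ P ∧ x ∉ Q) ∧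
      ∀ x ∈ degreeBelow A y n (d + 1), x ∈ P → x ∈ Q := by
    have hspec := Nat.find_spec hexists'
    have hlt := fun m => Nat.find_min hexists' (m := m)
    rcases hN : Nat.find hexists' with _ | _ | d
    · rw [hN] at hspec
      obtain ⟨x, hx, hxP, hxQ⟩ := hspec
      rw [degreeBelow_zero, Submodule.mem_bot] at hx
      exact absurd (hx ▸ Q.zero_mem) hxQ
    · rw [hN] at hspec
      obtain ⟨x, hx, hxP, hxQ⟩ := hspec
      exact absurd (hmin x (mem_level_of_mem_degreeBelow_one hx) hxP) hxQ
    · rw [hN] at hspec hlt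
      refine ⟨d, hspec, ?_⟩
      simpa using hlt (d + 1) (Nat.lt_succ_self _)
  obtain ⟨g, hg, c, hc, hfg⟩ := mem_degreeBelow_succ hf
  obtain ⟨s, hs, hDf, hEuler⟩ := exists_separant hA hy hf
  -- Otherwise `c ∈ Q` by minimality of the order, and `g = f - c * y n ^ (d + 1)` is in `P`, hence
  -- in `Q` by minimality of the degree; then `f ∈ Q`.
  have hcP : c ∉ P := fun h => by
    have hcQ := hmin c hc h
    refine hfQ (hfg ▸ Q.add_mem (hmin' g hg ?_) (Q.mul_mem_right _ hcQ))
    rw [← add_sub_cancel_right g (c * y n ^ (d + 1)), ← hfg]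
    exact P.sub_mem hfP (P.mul_mem_right _ h)
  -- Otherwise `s` and `y n * s - (d + 1) * f` are both in `Q` by minimality of the degree, so `(d +
  -- 1) * f ∈ Q`; characteristic zero gives `f ∈ Q`.
  have hsP : s ∉ P := fun h => by
    have hsQ := hmin' s hs h
    have h₁ := hmin' _ hEuler (P.sub_mem (P.mul_mem_left _ h) (P.mul_mem_left _ hfP))
    have h₂ := Q.sub_mem (Q.mul_mem_left (y n) hsQ) h₁
    rw [sub_sub_cancel] at h₂
    have h₃ := Q.mul_mem_left (algebraMap k R ((d + 1 : ℕ) : k)⁻¹) h₂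
    rw [← mul_assoc, ← _root_.map_natCast (algebraMap k R), ← map_mul,
      inv_mul_cancel₀ (Nat.cast_ne_zero.2 d.succ_ne_zero), map_one, one_mul] at h₃
    exact hfQ h₃
  have hcsP : c * s ∉ P := fun h => (mem_or_mem_of_maximal hP h).elim hcP hsP
  have hFP : ((insert f (E.image A.val) : Finset R) : Set R) ⊆ P := by
    rw [Finset.coe_insert]
    exact Set.insert_subset hfP hEP
  obtain ⟨x, hxP, hx⟩ := exists_mul_notMem_of_maximal hP hcsP _ hFP
  set B := D.radicalClosure ((insert f (E.image A.val) : Finset R) : Set R) with hBdef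
  have hB : D.IsRadicalDifferential B := isRadicalDifferential_radicalClosure _
  have hBP : B ≤ P := radicalClosure_le hP.1.1 hFP
  have hfB : f ∈ B := subset_radicalClosure _ (by simp)
  obtain ⟨N, r, hr, hrB⟩ := exists_separant_pow_mul_sub_mem hA hy hgen hB.map_mem hfB
    (mem_level_succ_of_mem_degreeBelow hs) hDf x
  obtain ⟨M, t, ht, htB⟩ := exists_initial_pow_mul_sub_mem hg hc (hfg ▸ hfB) hr
  have hsum : c ^ M * (s ^ N * x) - t ∈ B := by
    convert B.add_mem (B.mul_mem_left (c ^ M) hrB) htB using 1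
    ring
  have htP : t ∈ P := by
    rw [← sub_sub_cancel (c ^ M * (s ^ N * x)) t]
    exact P.sub_mem (P.mul_mem_left _ (P.mul_mem_left _ hxP)) (hBP hsum)
  have htB' : t ∈ B := hQle (Finset.subset_insert _ _) (hmin' t ht htP)
  have hfin : c ^ M * (s ^ N * x) ∈ B := by simpa using B.add_mem hsum htB'
  -- The exponent makes the power of `c * s * x` a multiple of `c ^ M * s ^ N * x`, even when `M` or
  -- `N` is zero.
  refine hx (hB.isRadical ⟨M + N + 1, ?_⟩)
  convert B.mul_mem_left (c ^ (N + 1) * s ^ (M + 1) * x ^ (M + N)) hfin using 1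
  ring

/-- The ascending chain condition on radical differential ideals. -/
theorem exists_forall_ge_eq_of_isRadicalDifferential [IsNoetherianRing A]
    (hA : ∀ a ∈ A, D a = 0) (hy : ∀ n, D (y n) = y (n + 1))
    (hgen : adjoin k ((A : Set R) ∪ Set.range y) = ⊤) {I : ℕ → Ideal R} (hmono : Monotone I)
    (hI : ∀ n, D.IsRadicalDifferential (I n)) : ∃ N, ∀ n, N ≤ n → I n = I N := by
  classical
  have hmem {x : R} : x ∈ ⨆ n, I n ↔ ∃ n, x ∈ I n :=
    Submodule.mem_iSup_of_directed _ hmono.directed_le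
  have hsup : D.IsRadicalDifferential (⨆ n, I n) := by
    refine ⟨?_, fun f hf => ?_⟩
    · rintro f ⟨m, hf⟩
      obtain ⟨n, hn⟩ := hmem.1 hf
      exact hmem.2 ⟨n, (hI n).isRadical ⟨m, hn⟩⟩
    · obtain ⟨n, hn⟩ := hmem.1 hf
      exact hmem.2 ⟨n, (hI n).map_mem f hn⟩
  obtain ⟨F, hF⟩ := hsup.isRadicalFG hA hy hgen
  have hFsub : ∀ x ∈ F, ∃ n, x ∈ I n :=
    fun x hx => hmem.1 (hF ▸ subset_radicalClosure (F : Set R) hx)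
  choose! φ hφ using hFsub
  refine ⟨F.sup φ, fun n hn => le_antisymm ?_ (hmono hn)⟩
  calc I n ≤ ⨆ n, I n := le_iSup I n
    _ = D.radicalClosure (F : Set R) := hF
    _ ≤ I (F.sup φ) := radicalClosure_le (hI _) fun x hx => hmono (Finset.le_sup hx) (hφ x hx)

end Derivation

/-! ### The order filtration and associated graded ideals -/

namespace UniversalEnvelopingAlgebra

noncomputable section

open Finset

variable (R : Type*) (L : Type*) [CommRing R] [LieRing L] [LieAlgebra R L]

/-- The projection of the tensor algebra onto its homogeneous part of degree `n`. -/
def tensorComponent (n : ℕ) : TensorAlgebra R L →ₗ[R] TensorAlgebra R L :=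
  GradedAlgebra.proj (fun n : ℕ => LinearMap.range (TensorAlgebra.ι R : L →ₗ[R] TensorAlgebra R L) ^ n) n

/-- The image of `L` in its universal enveloping algebra. -/
def generators : Submodule R (UniversalEnvelopingAlgebra R L) :=
  LinearMap.range ((mkAlgHom R L).toLinearMap ∘ₗ TensorAlgebra.ι R)

variable {R L}

theorem tensorComponent_mem (n : ℕ) (t : TensorAlgebra R L) :
    tensorComponent R L n t ∈ LinearMap.range (TensorAlgebra.ι R : L →ₗ[R] _) ^ n :=
  SetLike.coe_mem (DirectSum.decompose
    (fun n : ℕ => LinearMap.range (TensorAlgebra.ι R : L →ₗ[R] TensorAlgebra R L) ^ n) t n)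

theorem tensorComponent_of_mem {n : ℕ} {t : TensorAlgebra R L}
    (ht : t ∈ LinearMap.range (TensorAlgebra.ι R : L →ₗ[R] _) ^ n) :
    tensorComponent R L n t = t :=
  DirectSum.decompose_of_mem_same
    (fun n : ℕ => LinearMap.range (TensorAlgebra.ι R : L →ₗ[R] TensorAlgebra R L) ^ n) ht

theorem tensorComponent_of_mem_ne {m n : ℕ} {t : TensorAlgebra R L}
    (ht : t ∈ LinearMap.range (TensorAlgebra.ι R : L →ₗ[R] _) ^ m) (h : m ≠ n) :
    tensorComponent R L n t = 0 :=
  DirectSum.decompose_of_mem_ne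
    (fun n : ℕ => LinearMap.range (TensorAlgebra.ι R : L →ₗ[R] TensorAlgebra R L) ^ n) ht h

theorem tensorComponent_mul (n : ℕ) (s t : TensorAlgebra R L) :
    tensorComponent R L n (s * t) =
      ∑ ij ∈ antidiagonal n, tensorComponent R L ij.1 s * tensorComponent R L ij.2 t := by
  simp only [tensorComponent, GradedAlgebra.proj_apply, DirectSum.decompose_mul]
  exact DirectSum.coe_mul_apply_eq_sum_antidiagonal
    (fun n : ℕ => LinearMap.range (TensorAlgebra.ι R : L →ₗ[R] TensorAlgebra R L) ^ n) _ _ _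

theorem map_range_ι_pow (n : ℕ) :
    (LinearMap.range (TensorAlgebra.ι R : L →ₗ[R] _) ^ n).map (mkAlgHom R L).toLinearMap =
      generators R L ^ n := by
  rw [Submodule.map_pow, generators, LinearMap.range_comp]

theorem mkAlgHom_mem_generators_pow {n : ℕ} {t : TensorAlgebra R L}
    (ht : t ∈ LinearMap.range (TensorAlgebra.ι R : L →ₗ[R] _) ^ n) :
    mkAlgHom R L t ∈ generators R L ^ n :=
  map_range_ι_pow (R := R) (L := L) n ▸ Submodule.mem_map_of_mem ht

theorem generators_pow_le_orderLT {m n : ℕ} (h : m < n) : generators R L ^ m ≤ orderLT R L n :=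
  le_iSup (fun i : Fin n => generators R L ^ (i : ℕ)) ⟨m, h⟩

theorem orderLT_mono {m n : ℕ} (h : m ≤ n) : orderLT R L m ≤ orderLT R L n :=
  iSup_le fun i => generators_pow_le_orderLT (i.2.trans_le h)

theorem orderLT_zero : orderLT R L 0 = ⊥ := by
  simp [orderLT]

theorem orderLT_succ (n : ℕ) : orderLT R L (n + 1) = orderLT R L n ⊔ generators R L ^ n := by
  refine le_antisymm (iSup_le fun i => ?_)
    (sup_le (orderLT_mono n.le_succ) (generators_pow_le_orderLT n.lt_succ_self))
  rcases (Nat.lt_succ_iff.1 i.2).lt_or_eq with h | h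
  · exact (generators_pow_le_orderLT h).trans le_sup_left
  · rw [h]; exact le_sup_right

theorem mul_mem_orderLT_left {i j : ℕ} {u v : UniversalEnvelopingAlgebra R L}
    (hu : u ∈ generators R L ^ i) (hv : v ∈ orderLT R L j) : u * v ∈ orderLT R L (i + j) := by
  have h : generators R L ^ i * orderLT R L j ≤ orderLT R L (i + j) := by
    rw [orderLT, Submodule.mul_iSup]
    refine iSup_le fun l => ?_
    change generators R L ^ i * generators R L ^ (l : ℕ) ≤ _
    rw [← pow_add]
    exact generators_pow_le_orderLT (by omega)
  exact h (Submodule.mul_mem_mul hu hv)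

theorem mul_mem_orderLT_right {i j : ℕ} {u v : UniversalEnvelopingAlgebra R L}
    (hu : u ∈ orderLT R L i) (hv : v ∈ generators R L ^ j) : u * v ∈ orderLT R L (i + j) := by
  have h : orderLT R L i * generators R L ^ j ≤ orderLT R L (i + j) := by
    rw [orderLT, Submodule.iSup_mul]
    refine iSup_le fun l => ?_
    change generators R L ^ (l : ℕ) * generators R L ^ j ≤ _
    rw [← pow_add]
    exact generators_pow_le_orderLT (by omega)
  exact h (Submodule.mul_mem_mul hu hv)

theorem exists_mem_orderLT (u : UniversalEnvelopingAlgebra R L) : ∃ n, u ∈ orderLT R L n := by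
  classical
  obtain ⟨t, rfl⟩ : ∃ t, mkAlgHom R L t = u := RingCon.mkₐ_surjective (α := R) _ u
  have hmem {z} : z ∈ ⨆ n, orderLT R L n ↔ ∃ n, z ∈ orderLT R L n :=
    Submodule.mem_iSup_of_directed _ (Monotone.directed_le fun _ _ => orderLT_mono)
  rw [← hmem, ← DirectSum.sum_support_decompose
    (fun n : ℕ => LinearMap.range (TensorAlgebra.ι R : L →ₗ[R] TensorAlgebra R L) ^ n) t, map_sum]
  refine sum_mem fun n _ => hmem.2 ⟨n + 1, ?_⟩
  exact generators_pow_le_orderLT n.lt_succ_self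
    (mkAlgHom_mem_generators_pow (tensorComponent_mem n t))

theorem mkAlgHom_lie (x z : L) : mkAlgHom R L (TensorAlgebra.ι R ⁅x, z⁆) =
    mkAlgHom R L (TensorAlgebra.ι R x) * mkAlgHom R L (TensorAlgebra.ι R z) -
      mkAlgHom R L (TensorAlgebra.ι R z) * mkAlgHom R L (TensorAlgebra.ι R x) := by
  have h : mkAlgHom R L (TensorAlgebra.ι R ⁅x, z⁆ + TensorAlgebra.ι R z * TensorAlgebra.ι R x) =
      mkAlgHom R L (TensorAlgebra.ι R x * TensorAlgebra.ι R z) :=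
    Quotient.sound (RingCon.le_ringConGen _ _ (Rel.lie_compat x z))
  rw [map_add, map_mul, map_mul] at h
  exact eq_sub_of_add_eq h

variable (R L) in
/-- The tensors whose homogeneous components of degree `n` map to order less than `n`. -/
def symbolKernel : TwoSidedIdeal (TensorAlgebra R L) :=
  .mk' {t | ∀ n, mkAlgHom R L (tensorComponent R L n t) ∈ orderLT R L n}
    (fun n => by simp)
    (fun {s t} hs ht n => by simpa using add_mem (hs n) (ht n))
    (fun {t} ht n => by simpa using ht n)
    (fun {s t} ht n => by
      rw [tensorComponent_mul, map_sum]
      refine sum_mem fun ij hij => ?_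
      rw [← mem_antidiagonal.1 hij, map_mul]
      exact mul_mem_orderLT_left (mkAlgHom_mem_generators_pow (tensorComponent_mem _ _)) (ht _))
    (fun {s t} hs n => by
      rw [tensorComponent_mul, map_sum]
      refine sum_mem fun ij hij => ?_
      rw [← mem_antidiagonal.1 hij, map_mul]
      exact mul_mem_orderLT_right (hs _) (mkAlgHom_mem_generators_pow (tensorComponent_mem _ _)))

theorem mem_symbolKernel {t : TensorAlgebra R L} :
    t ∈ symbolKernel R L ↔ ∀ n, mkAlgHom R L (tensorComponent R L n t) ∈ orderLT R L n :=
  TwoSidedIdeal.mem_mk' ..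

/-- This commutator has degree `2` as a tensor, but its image in `U(L)` is the bracket, of order
`1`. -/
theorem ι_mul_ι_sub_mem_symbolKernel (x z : L) :
    TensorAlgebra.ι R x * TensorAlgebra.ι R z - TensorAlgebra.ι R z * TensorAlgebra.ι R x ∈
      symbolKernel R L := by
  have hmul (x z : L) : TensorAlgebra.ι R x * TensorAlgebra.ι R z ∈
      LinearMap.range (TensorAlgebra.ι R : L →ₗ[R] _) ^ 2 := by
    rw [pow_two]
    exact Submodule.mul_mem_mul ⟨x, rfl⟩ ⟨z, rfl⟩
  have hmem := sub_mem (hmul x z) (hmul z x)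
  refine mem_symbolKernel.2 fun n => ?_
  by_cases hn : 2 = n
  · subst hn
    rw [tensorComponent_of_mem hmem, map_sub, map_mul, map_mul, ← mkAlgHom_lie]
    refine generators_pow_le_orderLT one_lt_two ?_
    rw [pow_one]
    exact ⟨_, rfl⟩
  · rw [tensorComponent_of_mem_ne hmem hn, map_zero]
    exact zero_mem _

/-- Tensors with the same image in the symmetric algebra have homogeneous components with the same
classes in the associated graded algebra of `U(L)`. -/
theorem mkAlgHom_tensorComponent_sub_mem {s t : TensorAlgebra R L}
    (h : SymmetricAlgebra.algHom R L s = SymmetricAlgebra.algHom R L t) (n : ℕ) :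
    mkAlgHom R L (tensorComponent R L n s) - mkAlgHom R L (tensorComponent R L n t) ∈
      orderLT R L n := by
  have hle : TensorAlgebra.symRingCon R L ≤ (symbolKernel R L).ringCon := by
    refine RingCon.ringConGen_le.2 ?_
    rintro _ _ ⟨x, z⟩
    exact (TwoSidedIdeal.rel_iff _ _ _).2 (ι_mul_ι_sub_mem_symbolKernel x z)
  have hst := (TwoSidedIdeal.rel_iff _ _ _).1 (hle ((RingCon.eq _).1 h))
  simpa using mem_symbolKernel.1 hst n

/-- An element of `gr J` has homogeneous components which are symbols of elements of `J`. -/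
theorem exists_mem_of_mem_grIdeal {J : TwoSidedIdeal (UniversalEnvelopingAlgebra R L)}
    {f : SymmetricAlgebra R L} (hf : f ∈ grIdeal J) {t : TensorAlgebra R L}
    (ht : SymmetricAlgebra.algHom R L t = f) (n : ℕ) :
    ∃ v ∈ J, v - mkAlgHom R L (tensorComponent R L n t) ∈ orderLT R L n := by
  -- The choice of the lift does not matter, so sums and products can use the lifts supplied by the
  -- induction.
  suffices h : ∃ t, SymmetricAlgebra.algHom R L t = f ∧
      ∀ n, ∃ v ∈ J, v - mkAlgHom R L (tensorComponent R L n t) ∈ orderLT R L n by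
    obtain ⟨s, hs, h⟩ := h
    obtain ⟨v, hv, hvs⟩ := h n
    refine ⟨v, hv, ?_⟩
    simpa using add_mem hvs (mkAlgHom_tensorComponent_sub_mem (hs.trans ht.symm) n)
  clear ht t n
  induction hf using Submodule.span_induction with
  | mem f hf =>
    obtain ⟨m, u, hu, t, ht, hut, rfl⟩ := hf
    refine ⟨t, rfl, fun n => ?_⟩
    by_cases hn : m = n
    · subst hn
      exact ⟨u, hu, by rwa [tensorComponent_of_mem ht]⟩
    · exact ⟨0, J.zero_mem, by simp [tensorComponent_of_mem_ne ht hn]⟩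
  | zero => exact ⟨0, map_zero _, fun n => ⟨0, J.zero_mem, by simp⟩⟩
  | add f g _ _ hf hg =>
    obtain ⟨s, rfl, hs⟩ := hf
    obtain ⟨t, rfl, ht⟩ := hg
    refine ⟨s + t, map_add _ _ _, fun n => ?_⟩
    obtain ⟨u, hu, hus⟩ := hs n
    obtain ⟨v, hv, hvt⟩ := ht n
    refine ⟨u + v, J.add_mem hu hv, ?_⟩
    convert add_mem hus hvt using 1
    rw [map_add, map_add]
    abel
  | smul a f _ hf =>
    obtain ⟨s, rfl⟩ := SymmetricAlgebra.algHom_surjective R L a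
    obtain ⟨t, rfl, ht⟩ := hf
    choose v hv hvt using ht
    refine ⟨s * t, by rw [map_mul, smul_eq_mul], fun n => ?_⟩
    refine ⟨∑ ij ∈ antidiagonal n, mkAlgHom R L (tensorComponent R L ij.1 s) * v ij.2,
      sum_mem fun ij _ => J.mul_mem_left _ _ (hv _), ?_⟩
    rw [tensorComponent_mul, map_sum, ← sum_sub_distrib]
    refine sum_mem fun ij hij => ?_
    rw [← mem_antidiagonal.1 hij, map_mul, ← mul_sub]
    exact mul_mem_orderLT_left (mkAlgHom_mem_generators_pow (tensorComponent_mem _ _)) (hvt _)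

theorem grIdeal_mono {I J : TwoSidedIdeal (UniversalEnvelopingAlgebra R L)} (h : I ≤ J) :
    grIdeal I ≤ grIdeal J := by
  refine Ideal.span_mono ?_
  rintro f ⟨n, u, hu, hf⟩
  exact ⟨n, u, h hu, hf⟩

/-- Induction on the order of `u ∈ J`: some `v ∈ I` has the same symbol as `u`, and `u - v ∈ J` has
smaller order. -/
theorem eq_of_le_of_grIdeal_le {I J : TwoSidedIdeal (UniversalEnvelopingAlgebra R L)} (hle : I ≤ J)
    (hgr : grIdeal J ≤ grIdeal I) : I = J := by
  refine le_antisymm hle fun u hu => ?_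
  obtain ⟨n, hn⟩ := exists_mem_orderLT u
  induction n generalizing u with
  | zero =>
    rw [orderLT_zero, Submodule.mem_bot] at hn
    exact hn ▸ I.zero_mem
  | succ n ih =>
    rw [orderLT_succ, ← map_range_ι_pow, Submodule.mem_sup] at hn
    obtain ⟨w, hw, _, ⟨t, ht, rfl⟩, rfl⟩ := hn
    have hsymb : SymmetricAlgebra.algHom R L t ∈ grIdeal J :=
      Ideal.subset_span ⟨n, _, hu, t, ht, by simpa using hw, rfl⟩
    obtain ⟨v, hv, hvt⟩ := exists_mem_of_mem_grIdeal (hgr hsymb) rfl n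
    rw [tensorComponent_of_mem ht] at hvt
    have hdiff := ih _ (J.sub_mem hu (hle hv)) (by
      convert sub_mem hw hvt using 1
      simp only [AlgHom.toLinearMap_apply]
      abel)
    simpa using I.add_mem hdiff hv

end

end UniversalEnvelopingAlgebra

/-! ### Derivations of the symmetric algebra -/

namespace SymmetricAlgebra

noncomputable section

variable {R M : Type*} [CommRing R] [AddCommGroup M] [Module R M]

/-- The homomorphism `f ↦ f + ε D f` into the dual numbers, for the derivation `D` of the symmetric
algebra which extends `φ`. -/
def dualNumberLift (φ : M →ₗ[R] M) :
    SymmetricAlgebra R M →ₐ[R] TrivSqZeroExt (SymmetricAlgebra R M) (SymmetricAlgebra R M) :=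
  lift ((TrivSqZeroExt.inlAlgHom R _ _).toLinearMap ∘ₗ ι R M +
    (TrivSqZeroExt.inrHom (SymmetricAlgebra R M) _).restrictScalars R ∘ₗ ι R M ∘ₗ φ)

/-- Because the first component is the identity, multiplicativity of the lift becomes the Leibniz
rule for the second. -/
theorem fst_dualNumberLift (φ : M →ₗ[R] M) (f : SymmetricAlgebra R M) :
    (dualNumberLift φ f).fst = f := by
  have h : (TrivSqZeroExt.fstHom R _ _).comp (dualNumberLift φ) = AlgHom.id R _ := by
    ext x
    simp [dualNumberLift]
  exact congr($h f)

/-- The derivation of the symmetric algebra which extends `φ`. -/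
def derivation (φ : M →ₗ[R] M) : Derivation R (SymmetricAlgebra R M) (SymmetricAlgebra R M) :=
  Derivation.mk' ((TrivSqZeroExt.sndHom (SymmetricAlgebra R M) _).restrictScalars R ∘ₗ
    (dualNumberLift φ).toLinearMap) fun f g => by
      simp [TrivSqZeroExt.snd_mul, fst_dualNumberLift, mul_comm]

theorem derivation_ι (φ : M →ₗ[R] M) (x : M) : derivation φ (ι R M x) = ι R M (φ x) := by
  simp [derivation, dualNumberLift]

theorem adjoin_ι_basis {σ : Type*} (b : Module.Basis σ R M) :
    Algebra.adjoin R (Set.range fun i => ι R M (b i)) = ⊤ := by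
  refine eq_top_iff.2 fun f _ => ?_
  induction f using SymmetricAlgebra.induction with
  | algebraMap r => exact Subalgebra.algebraMap_mem _ r
  | ι x =>
    induction b.mem_span x using Submodule.span_induction with
    | mem x hx =>
      obtain ⟨i, rfl⟩ := hx
      exact Algebra.subset_adjoin ⟨i, rfl⟩
    | zero => simp
    | add x z _ _ hx hz => rw [map_add]; exact add_mem (hx trivial) (hz trivial)
    | smul c x _ hx => rw [map_smul]; exact Subalgebra.smul_mem _ (hx trivial) c
  | mul f g hf hg => exact mul_mem (hf trivial) (hg trivial)
  | add f g hf hg => exact add_mem (hf trivial) (hg trivial)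

end

end SymmetricAlgebra

/-! ### Stability of associated graded ideals under Poisson brackets -/

namespace UniversalEnvelopingAlgebra

open SymmetricAlgebra

variable {R L : Type*} [CommRing R] [LieRing L] [LieAlgebra R L]

/-- The adjoint action of `x` on `U(L)` and the Poisson bracket with `x` on `S(L)` are induced by
the same map on homogeneous tensors. -/
theorem exists_tensor_lie (x : L) {n : ℕ} {t : TensorAlgebra R L}
    (ht : t ∈ LinearMap.range (TensorAlgebra.ι R : L →ₗ[R] _) ^ n) :
    ∃ s ∈ LinearMap.range (TensorAlgebra.ι R : L →ₗ[R] TensorAlgebra R L) ^ n,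
      mkAlgHom R L s = ι R x * mkAlgHom R L t - mkAlgHom R L t * ι R x ∧
        algHom R L s = derivation (LieAlgebra.ad R L x : L →ₗ[R] L) (algHom R L t) := by
  induction ht using Submodule.pow_induction_on_left' with
  | algebraMap r =>
    refine ⟨0, zero_mem _, ?_, ?_⟩
    · rw [map_zero, AlgHom.commutes, Algebra.commutes, sub_self]
    · rw [map_zero, AlgHom.commutes, Derivation.map_algebraMap]
  | add t₁ t₂ i _ _ h₁ h₂ =>
    obtain ⟨s₁, hs₁, hU₁, hS₁⟩ := h₁
    obtain ⟨s₂, hs₂, hU₂, hS₂⟩ := h₂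
    refine ⟨s₁ + s₂, add_mem hs₁ hs₂, ?_, ?_⟩
    · rw [map_add, map_add, hU₁, hU₂]; noncomm_ring
    · rw [map_add, map_add, map_add, hS₁, hS₂]
  | mem_mul m hm i t ht h =>
    obtain ⟨z, rfl⟩ := hm
    obtain ⟨s, hs, hU, hS⟩ := h
    -- The Leibniz rule for the action of `x` on `z ⊗ t`, which keeps the tensor degree.
    refine ⟨TensorAlgebra.ι R ⁅x, z⁆ * t + TensorAlgebra.ι R z * s, ?_, ?_, ?_⟩
    · rw [Nat.succ_eq_add_one, pow_succ']
      exact add_mem (Submodule.mul_mem_mul ⟨_, rfl⟩ ht) (Submodule.mul_mem_mul ⟨_, rfl⟩ hs)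
    · rw [map_add, map_mul, map_mul, map_mul, hU, mkAlgHom_lie, ι_apply]
      noncomm_ring
    · have hι (z : L) : algHom R L (TensorAlgebra.ι R z) = SymmetricAlgebra.ι R L z := rfl
      rw [map_add, map_mul, map_mul, map_mul, hS, Derivation.leibniz, hι, hι, derivation_ι,
        smul_eq_mul, smul_eq_mul, LieAlgebra.ad_apply]
      ring

theorem lie_mem_orderLT (x : L) {n : ℕ} {u : UniversalEnvelopingAlgebra R L}
    (hu : u ∈ orderLT R L n) : ι R x * u - u * ι R x ∈ orderLT R L n := by
  let φ : UniversalEnvelopingAlgebra R L →ₗ[R] UniversalEnvelopingAlgebra R L :=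
    LinearMap.mulLeft R (ι R x) - LinearMap.mulRight R (ι R x)
  have h : orderLT R L n ≤ (orderLT R L n).comap φ := by
    refine iSup_le fun i => ?_
    change generators R L ^ (i : ℕ) ≤ _
    rw [← map_range_ι_pow]
    rintro _ ⟨t, ht, rfl⟩
    obtain ⟨s, hs, hU, -⟩ := exists_tensor_lie x ht
    have := generators_pow_le_orderLT i.2 (mkAlgHom_mem_generators_pow hs)
    rwa [hU] at this
  exact h hu

/-- The associated graded ideal of a two-sided ideal is stable under Poisson brackets with
elements of `L`. -/
theorem derivation_ad_mem_grIdeal {J : TwoSidedIdeal (UniversalEnvelopingAlgebra R L)} (x : L)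
    {f : SymmetricAlgebra R L} (hf : f ∈ grIdeal J) :
    derivation (LieAlgebra.ad R L x : L →ₗ[R] L) f ∈ grIdeal J := by
  induction hf using Submodule.span_induction with
  | mem f hf =>
    obtain ⟨n, u, hu, t, ht, hut, rfl⟩ := hf
    obtain ⟨s, hs, hU, hS⟩ := exists_tensor_lie x ht
    refine Ideal.subset_span ⟨n, ι R x * u - u * ι R x, ?_, s, hs, ?_, hS⟩
    · exact J.sub_mem (J.mul_mem_left _ _ hu) (J.mul_mem_right _ _ hu)
    · convert lie_mem_orderLT x hut using 1
      rw [hU]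
      noncomm_ring
  | zero => simp
  | add f g _ _ hf hg => rw [map_add]; exact add_mem hf hg
  | smul a f hf' hf =>
    rw [smul_eq_mul, Derivation.leibniz]
    exact add_mem (Ideal.mul_mem_left _ _ hf) (Ideal.mul_mem_right _ _ hf')

end UniversalEnvelopingAlgebra

/-! ### The differential structure of the symmetric algebra of the positive Witt algebra -/

namespace PositiveWitt

open SymmetricAlgebra

variable (k : Type*) [Field k] [CharZero k]

/-- The Poisson bracket with `e 1` on `S(W₊)`. -/
noncomputable def poissonOne :
    Derivation k (SymmetricAlgebra k (PositiveWitt k)) (SymmetricAlgebra k (PositiveWitt k)) :=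
  derivation (LieAlgebra.ad k (PositiveWitt k) (e k 1) : PositiveWitt k →ₗ[k] PositiveWitt k)

/-- The iterated brackets `n! e (n + 2)` of `e 2` with `e 1`. -/
noncomputable def iteratedBracket (n : ℕ) : SymmetricAlgebra k (PositiveWitt k) :=
  (n.factorial : k) • SymmetricAlgebra.ι k _ (e k (n + 1).succPNat)

theorem poissonOne_ι_e (n : ℕ+) : poissonOne k (SymmetricAlgebra.ι k _ (e k n)) =
    (((n : ℕ) : k) - 1) • SymmetricAlgebra.ι k _ (e k (1 + n)) := by
  rw [poissonOne, derivation_ι, LieAlgebra.ad_apply, lie_e_e, map_smul]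
  simp

/-- Bracketing `e 1` with `e (n + 2)` produces the factor `n + 1`, which the factorial absorbs. -/
theorem poissonOne_iteratedBracket (n : ℕ) :
    poissonOne k (iteratedBracket k n) = iteratedBracket k (n + 1) := by
  have h : 1 + (n + 1).succPNat = (n + 1 + 1).succPNat := by
    apply PNat.eq
    simp only [PNat.add_coe, PNat.one_coe, Nat.succPNat_coe]
    omega
  rw [iteratedBracket, Derivation.map_smul, poissonOne_ι_e, h, smul_smul, iteratedBracket,
    Nat.factorial_succ, Nat.succPNat_coe]
  congr 1
  push_cast
  ring

theorem adjoin_iteratedBracket :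
    Algebra.adjoin k ((Algebra.adjoin k {SymmetricAlgebra.ι k _ (e k 1)} :
      Set (SymmetricAlgebra k (PositiveWitt k))) ∪ Set.range (iteratedBracket k)) = ⊤ := by
  refine top_le_iff.1 ?_
  rw [← adjoin_ι_basis (basis k)]
  refine Algebra.adjoin_le ?_
  rintro _ ⟨n, rfl⟩
  change SymmetricAlgebra.ι k _ (e k n) ∈ _
  obtain ⟨n, rfl⟩ : ∃ m : ℕ, n = m.succPNat := ⟨n.natPred, n.succPNat_natPred.symm⟩
  -- Index `0` is `e 1`, which lies in the constants; index `n + 1` is `e (n + 2)`, recovered by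
  -- inverting `n!` in characteristic zero.
  rcases n with _ | n
  · exact Algebra.subset_adjoin (Or.inl (Algebra.subset_adjoin rfl))
  · have h := Subalgebra.smul_mem _ (Algebra.subset_adjoin (R := k) (s :=
      (Algebra.adjoin k {SymmetricAlgebra.ι k _ (e k 1)} :
        Set (SymmetricAlgebra k (PositiveWitt k))) ∪ Set.range (iteratedBracket k))
      (Or.inr ⟨n, rfl⟩)) ((n.factorial : k)⁻¹)
    rwa [iteratedBracket, smul_smul,
      inv_mul_cancel₀ (Nat.cast_ne_zero.2 n.factorial_ne_zero), one_smul] at h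

theorem poissonOne_eq_zero {a : SymmetricAlgebra k (PositiveWitt k)}
    (ha : a ∈ Algebra.adjoin k {SymmetricAlgebra.ι k (PositiveWitt k) (e k 1)}) :
    poissonOne k a = 0 := by
  induction ha using Algebra.adjoin_induction with
  | mem a ha =>
    rw [Set.mem_singleton_iff.1 ha, poissonOne_ι_e]
    simp
  | algebraMap r => simp
  | add a b _ _ ha hb => rw [map_add, ha, hb, add_zero]
  | mul a b _ _ ha hb => rw [Derivation.leibniz, ha, hb, smul_zero, smul_zero, add_zero]

instance : IsNoetherianRing
    (Algebra.adjoin k {SymmetricAlgebra.ι k (PositiveWitt k) (e k 1)}) :=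
  isNoetherianRing_of_fg (Subalgebra.fg_def.2 ⟨_, Set.finite_singleton _, rfl⟩)

end PositiveWitt

theorem corollary2p14 (k : Type*) [Field k] [CharZero k]
    (J : ℕ → TwoSidedIdeal (UniversalEnvelopingAlgebra k (PositiveWitt k)))
    (hmono : Monotone J)
    (hrad : ∀ n, (UniversalEnvelopingAlgebra.grIdeal (J n)).IsRadical) :
    ∃ N, ∀ n, N ≤ n → J n = J N := by
  have hchain := Derivation.exists_forall_ge_eq_of_isRadicalDifferential
    (I := fun n => UniversalEnvelopingAlgebra.grIdeal (J n))
    (fun a ha => PositiveWitt.poissonOne_eq_zero k ha)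
    (PositiveWitt.poissonOne_iteratedBracket k) (PositiveWitt.adjoin_iteratedBracket k)
    (fun _ _ h => UniversalEnvelopingAlgebra.grIdeal_mono (hmono h))
    (fun n => ⟨hrad n, fun _ => UniversalEnvelopingAlgebra.derivation_ad_mem_grIdeal _⟩)
  obtain ⟨N, hN⟩ := hchain
  exact ⟨N, fun n hn =>
    (UniversalEnvelopingAlgebra.eq_of_le_of_grIdeal_le (hmono hn) (hN n hn).le).symm⟩
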